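/- **Setting.** Fix $\rho\in\mathbb R$, $\sigma,S_0,\tau,T>0$ and let $\Theta=\{\theta=(\lambda,\delta^2,m):\lambda>0,\ \delta^2>0,\ m\in\mathbb R\}$ with Lebesgue measure $d\theta=d\lambda\,d\delta^2\,dm$. On a measurable space $\Omega$ let $S_t=S_0e^{X_t}$, $$X_t=\rho t+\sigma W_t+J_t,\qquad J_t=\sum_{j=\pm1}^{N_t}Y_j,\qquad t\in[-\tau,T],$$ where $W$ has continuous paths, $N$ is integer valued with non-decreasing, right-continuous paths, $W_0=N_0=0$, and the sum is $Y_1+\dots+Y_{N_t}$ if $N_t\ge 0$ and $-(Y_{-1}+\dots+Y_{N_t})$ if $N_t<0$. Let $(P_\theta)_{\theta\in\Theta}$ be probability measures on $\Omega$ such that under $P_\theta$ the families $W$, $N$, $(Y_j)_{j\ne0}$ are independent, $W$ is a Brownian motion and $N$ a Poisson process of intensity $\lambda$ on $[-\tau,T]$ (independent increments with $W_t-W_s\sim N(0,t-s)$ and $N_t-N_s\sim\mathrm{Poisson}(\lambda(t-s))$ for $s\le t$), and the $Y_j$ are i.i.d. with law $N(m,\delta^2)$. Let $(\mathscr F^+_t)_{t\in[0,T]}$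 be a filtration to which $(W_t)_{t\in[0,T]}$ and $(J_t)_{t\in[0,T]}$ are adapted and such that, under every $P_\theta$, $(W_u-W_s,J_u-J_s)_{u\in[s,T]}$ is independent of $\mathscr F^+_s$ for all $s\in[0,T]$, and $\mathscr F^+_T$ is independent of the increments of $X$ on $[-\tau,0]$. Assume that $\theta\mapsto P_\theta(A)$ is Borel measurable for every $A\in\mathscr F_T^+$. The mean-corrected martingale measure is, on $\mathscr F^+_T$, $$Q_\theta=L_TP_\theta,\qquad L_T=\exp\Big(\tfrac{\mu_\theta}{\sigma}W_T-\tfrac12\big(\tfrac{\mu_\theta}{\sigma}\big)^2T\Big),\qquad \mu_\theta=-\tfrac12\sigma^2-\lambda\big(e^{\frac12\delta^2+m}-1\big).$$ Fix $\theta_0=(\lambda_0,\delta_0^2,m_0)\in\Theta$ and an outcome $\omega_0\in\Omega$, whose path $(S_t)_{t\in[-\tau,0]}$ is observed. With $\nu_\theta=\lambda N(m,\delta^2)$ and the jumps $\Delta X_s=X_s-X_{s-}$ of the observed path, the likelihood is $$L(\theta|\theta_0)=\exp\Big\{\tau(\lambda_0-\lambda)+\sum_{-\tau<s\le0,\ \Delta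 X_s\neq0}\log\frac{d\nu_\theta}{d\nu_{\theta_0}}(\Delta X_s)\Big\},$$ with the continuous version (the quotient of the Lebesgue densities) of $d\nu_\theta/d\nu_{\theta_0}$. A prior is a non-negative, bounded, continuous function $\pi$ on $\Theta$. If $0<\int_\Theta L(\xi|\theta_0)\pi(\xi)\,d\xi<\infty$, we say that the posterior is well defined and set $$f_\tau(\theta|\pi)=\frac{L(\theta|\theta_0)\pi(\theta)}{\int_\Theta L(\xi|\theta_0)\pi(\xi)\,d\xi},\quad P_\pi(A)=\int_\Theta P_\theta(A)f_\tau(\theta|\pi)\,d\theta,\quad Q_\pi(A)=\int_\Theta Q_\theta(A)f_\tau(\theta|\pi)\,d\theta,\quad A\in\mathscr F^+_T.$$ **Theorem.** Let $\pi,\pi'$ be priors such that $\pi(\theta)\,d\theta$ and $\pi'(\theta)\,d\theta$ are equivalent measures and both posteriors are well defined. Then $Q_{\pi'}$ is an equivalent martingale measure for the subjective Merton market measure $P_\pi$: $P_\pi$ and $Q_{\pi'}$ are probability measures on $\mathscr F_T^+$ with the same null sets, and the discounted price $(e^{-\rho t}S_t)_{t\in[0,T]}$ is a martingale under $Q_{\pi'}$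 with respect to $(\mathscr F^+_t)_{t\in[0,T]}$. -/

import Mathlib

open MeasureTheory ProbabilityTheory

noncomputable section

/-- The parameter space `Θ = ℝ₊ × ℝ₊ × ℝ` of the Merton model: triples `θ = (lam, δ², m)` with jump
intensity `lam > 0`, jump variance `δ² > 0` and jump mean `m`. It carries the subspace
topology and Borel σ-algebra of `ℝ³`. -/
abbrev MertonParam : Type := {θ : ℝ × ℝ × ℝ // 0 < θ.1 ∧ 0 < θ.2.1}

namespace MertonParam

/-- Lebesgue measure `dθ` on the parameter space. -/
def lebesgue : Measure MertonParam := Measure.comap Subtype.val volume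

/-- The jump intensity. -/
def intensity (θ : MertonParam) : ℝ := θ.1.1

/-- The variance `δ²` of the jump heights. -/
def jumpVar (θ : MertonParam) : ℝ := θ.1.2.1

/-- The mean `m` of the jump heights. -/
def jumpMean (θ : MertonParam) : ℝ := θ.1.2.2

/-- The law `N(m, δ²)` of the jump heights. -/
def jumpLaw (θ : MertonParam) : Measure ℝ := gaussianReal θ.jumpMean θ.jumpVar.toNNReal

/-- The Lebesgue density of the Lévy measure `ν_θ = lam • N(m, δ²)`. -/
def levyDensity (θ : MertonParam) (y : ℝ) : ℝ :=
  θ.intensity * gaussianPDFReal θ.jumpMean θ.jumpVar.toNNReal y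

/-- The (continuous version of the) Radon-Nikodym derivative `dν_θ / dν_θ₀` of two Lévy measures. -/
def levyRatio (θ θ₀ : MertonParam) (y : ℝ) : ℝ := θ.levyDensity y / θ₀.levyDensity y

end MertonParam

/-- The oriented sum `∑_{j = ±1}^n y_j`: for `n ≥ 0` it is `y_1 + ... + y_n`, for `n < 0` it is
`-(y_{-1} + ... + y_n)`, so that a step from `n - 1` to `n` always adds one of the `y_j`. -/
def jumpSum (y : ℤ → ℝ) (n : ℤ) : ℝ :=
  ∑ j ∈ Finset.Icc 1 n, y j - ∑ j ∈ Finset.Icc n (-1), y j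

/-- A Merton jump-diffusion market with observation period `[-τ, 0]` and maturity `T`: the driving
processes on a space `Ω`, the filtration `ℱ` of the future, and the family of measures `P θ`,
one for each parameter, that turn them into a Brownian motion, a Poisson process and a
sequence of Gaussian jump heights. -/
structure MertonMarket (Ω : Type*) [mΩ : MeasurableSpace Ω] where
  /-- interest rate -/
  ρ : ℝ
  /-- volatility -/
  σ : ℝ
  /-- price at the present time `0` -/
  S₀ : ℝ
  /-- length of the observation period -/
  τ : ℝ
  /-- maturity -/
  T : ℝ
  σ_pos : 0 < σ
  S₀_pos : 0 < S₀
  τ_pos : 0 < τ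
  T_pos : 0 < T
  /-- Brownian motion, used on `[-τ, T]` only -/
  W : ℝ → Ω → ℝ
  /-- Poisson process, used on `[-τ, T]` only -/
  N : ℝ → Ω → ℤ
  /-- jump heights `Y_j`, used for `j ≠ 0` only -/
  Y : ℤ → Ω → ℝ
  /-- the filtration `ℱ⁺` of the future -/
  ℱ : Filtration (Set.Icc (0 : ℝ) T) mΩ
  /-- the market measures -/
  P : MertonParam → Measure Ω
  isProb : ∀ θ, IsProbabilityMeasure (P θ)
  measurable_W : ∀ t ∈ Set.Icc (-τ) T, Measurable (W t)
  measurable_N : ∀ t ∈ Set.Icc (-τ) T, Measurable (N t)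
  measurable_Y : ∀ j, j ≠ 0 → Measurable (Y j)
  -- paths
  W_zero : ∀ ω, W 0 ω = 0
  W_cont : ∀ ω, ContinuousOn (fun t => W t ω) (Set.Icc (-τ) T)
  N_zero : ∀ ω, N 0 ω = 0
  N_mono : ∀ ω, MonotoneOn (fun t => N t ω) (Set.Icc (-τ) T)
  N_rightCont : ∀ ω, ∀ t ∈ Set.Ico (-τ) T, ContinuousWithinAt (fun u => N u ω) (Set.Ici t) t
  -- laws of the components under `P θ`
  W_indepIncr : ∀ θ, HasIndepIncrements (fun (t : Set.Icc (-τ) T) ω => W t ω) (P θ)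
  W_law : ∀ θ, ∀ s ∈ Set.Icc (-τ) T, ∀ t ∈ Set.Icc (-τ) T, s ≤ t →
    HasLaw (fun ω => W t ω - W s ω) (gaussianReal 0 (t - s).toNNReal) (P θ)
  N_indepIncr : ∀ θ, HasIndepIncrements (fun (t : Set.Icc (-τ) T) ω => N t ω) (P θ)
  N_law : ∀ θ, ∀ s ∈ Set.Icc (-τ) T, ∀ t ∈ Set.Icc (-τ) T, s ≤ t →
    HasLaw (fun ω => N t ω - N s ω)
      ((poissonMeasure (θ.intensity * (t - s)).toNNReal).map (fun n : ℕ => (n : ℤ))) (P θ)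
  Y_iIndep : ∀ θ, iIndepFun (fun (j : {j : ℤ // j ≠ 0}) => Y j) (P θ)
  Y_law : ∀ θ, ∀ j, j ≠ 0 → HasLaw (Y j) θ.jumpLaw (P θ)
  -- the components `W`, `N`, `Y` are independent
  indep_N_Y : ∀ θ, IndepFun (fun ω (t : Set.Icc (-τ) T) => N t ω)
    (fun ω (j : {j : ℤ // j ≠ 0}) => Y j ω) (P θ)
  indep_W_NY : ∀ θ, IndepFun (fun ω (t : Set.Icc (-τ) T) => W t ω)
    (fun ω => ((fun t : Set.Icc (-τ) T => N t ω), (fun j : {j : ℤ // j ≠ 0} => Y j ω))) (P θ)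
  -- the diffusion part and the jump part are adapted, their future increments are independent of
  -- the present information, and the whole future is independent of the observed past
  adapted_W : ∀ t : Set.Icc (0 : ℝ) T, Measurable[ℱ t] (W t)
  adapted_jump : ∀ t : Set.Icc (0 : ℝ) T, Measurable[ℱ t] (fun ω => jumpSum (Y · ω) (N t ω))
  indep_future : ∀ θ, ∀ s : Set.Icc (0 : ℝ) T,
    Indep (ℱ s) (MeasurableSpace.comap (fun ω (u : Set.Icc (s : ℝ) T) =>
      (W u ω - W s ω, jumpSum (Y · ω) (N u ω) - jumpSum (Y · ω) (N s ω))) inferInstance) (P θ)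
  indep_past : ∀ θ,
    Indep (ℱ ⟨T, T_pos.le, le_rfl⟩)
      (MeasurableSpace.comap (fun ω (u : Set.Icc (-τ) 0 × Set.Icc (-τ) 0) =>
        (ρ * u.1 + σ * W u.1 ω + jumpSum (Y · ω) (N u.1 ω))
          - (ρ * u.2 + σ * W u.2 ω + jumpSum (Y · ω) (N u.2 ω))) inferInstance) (P θ)
  /-- On the σ-algebra of the future the market measures depend measurably on the parameter. -/
  measurable_P : ∀ A, MeasurableSet[ℱ ⟨T, T_pos.le, le_rfl⟩] A → Measurable (fun θ => P θ A)

namespace MertonMarket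

variable {Ω : Type*} [mΩ : MeasurableSpace Ω]

/-- The log-price `X_t = ρ t + σ W_t + ∑_{j = ±1}^{N_t} Y_j`. -/
def X (M : MertonMarket Ω) (t : ℝ) (ω : Ω) : ℝ :=
  M.ρ * t + M.σ * M.W t ω + jumpSum (M.Y · ω) (M.N t ω)

/-- The asset price `S_t = S₀ exp X_t`. -/
def S (M : MertonMarket Ω) (t : ℝ) (ω : Ω) : ℝ := M.S₀ * Real.exp (M.X t ω)

/-- The discounted price process `exp (-ρ t) S_t`, `0 ≤ t ≤ T`. -/
def discountedPrice (M : MertonMarket Ω) (t : Set.Icc (0 : ℝ) M.T) (ω : Ω) : ℝ :=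
  Real.exp (-M.ρ * t) * M.S t ω

/-- The σ-algebra `ℱ⁺_T` of the future. -/
abbrev futureSigma (M : MertonMarket Ω) : MeasurableSpace Ω := M.ℱ ⟨M.T, M.T_pos.le, le_rfl⟩

/-- The filtration `ℱ⁺` as a filtration of the measurable space `(Ω, ℱ⁺_T)`. -/
def futureFiltration (M : MertonMarket Ω) :
    @Filtration Ω (Set.Icc (0 : ℝ) M.T) _ M.futureSigma where
  seq := M.ℱ
  mono' := M.ℱ.mono'
  le' t := M.ℱ.mono t.2.2

/-- The market measure `P_θ` on `ℱ⁺_T`. -/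
def marketMeasure (M : MertonMarket Ω) (θ : MertonParam) : @Measure Ω M.futureSigma :=
  (M.P θ).trim (M.ℱ.le _)

/-- The mean correction `μ_θ = -σ²/2 - lam (exp (δ²/2 + m) - 1)`. -/
def meanCorrection (M : MertonMarket Ω) (θ : MertonParam) : ℝ :=
  -(1 / 2) * M.σ ^ 2 - θ.intensity * (Real.exp (θ.jumpVar / 2 + θ.jumpMean) - 1)

/-- The Girsanov density `L_T = exp ((μ_θ/σ) W_T - (μ_θ/σ)² T / 2)`, which adds the drift `μ_θ` to
`σ W`. -/
def girsanovDensity (M : MertonMarket Ω) (θ : MertonParam) (ω : Ω) : ℝ :=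
  Real.exp (M.meanCorrection θ / M.σ * M.W M.T ω
    - (M.meanCorrection θ / M.σ) ^ 2 * M.T / 2)

/-- The mean-corrected pricing measure `Q_θ = L_T P_θ` on `ℱ⁺_T`. -/
def pricingMeasure (M : MertonMarket Ω) (θ : MertonParam) : @Measure Ω M.futureSigma :=
  (M.marketMeasure θ).withDensity (fun ω => ENNReal.ofReal (M.girsanovDensity θ ω))

/-- The jump `ΔX_s = X_s - X_{s-}` of the log-price. -/
def jump (M : MertonMarket Ω) (ω : Ω) (s : ℝ) : ℝ :=
  M.X s ω - Function.leftLim (fun t => M.X t ω) s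

/-- The jump times of the log-price in the observation period. -/
def jumpTimes (M : MertonMarket Ω) (ω : Ω) : Set ℝ :=
  {s | s ∈ Set.Ioc (-M.τ) 0 ∧ M.jump ω s ≠ 0}

/-- The likelihood `L(θ|θ₀) = exp (τ (lam₀ - lam) + ∑_s log (dν_θ/dν_θ₀ (ΔX_s)))` of the log-price
path observed on `[-τ, 0]`, in the outcome `ω`; the sum is over the jump times. -/
def likelihood (M : MertonMarket Ω) (θ₀ : MertonParam) (ω : Ω) (θ : MertonParam) : ℝ :=
  Real.exp (M.τ * (θ₀.intensity - θ.intensity)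
    + ∑ᶠ s ∈ M.jumpTimes ω, Real.log (θ.levyRatio θ₀ (M.jump ω s)))

/-- The a posteriori density of the parameter. -/
def posteriorDensity (M : MertonMarket Ω) (θ₀ : MertonParam) (ω : Ω) (π : MertonParam → ℝ)
    (θ : MertonParam) : ℝ :=
  M.likelihood θ₀ ω θ * π θ / ∫ ξ, M.likelihood θ₀ ω ξ * π ξ ∂MertonParam.lebesgue

/-- The normalizing integral of the a posteriori density is finite and positive. -/
def PosteriorWellDefined (M : MertonMarket Ω) (θ₀ : MertonParam) (ω : Ω)
    (π : MertonParam → ℝ) : Prop :=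
  Integrable (fun ξ => M.likelihood θ₀ ω ξ * π ξ) MertonParam.lebesgue ∧
    0 < ∫ ξ, M.likelihood θ₀ ω ξ * π ξ ∂MertonParam.lebesgue

/-- The a posteriori distribution of the parameter. -/
def posterior (M : MertonMarket Ω) (θ₀ : MertonParam) (ω : Ω) (π : MertonParam → ℝ) :
    Measure MertonParam :=
  MertonParam.lebesgue.withDensity (fun θ => ENNReal.ofReal (M.posteriorDensity θ₀ ω π θ))

/-- The subjective market measure `P_π(A) = ∫ P_θ(A) f_τ(θ|π) dθ`, `A ∈ ℱ⁺_T`, where `ω` is the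
outcome whose past path has been observed. -/
def subjectiveMarketMeasure (M : MertonMarket Ω) (θ₀ : MertonParam) (ω : Ω)
    (π : MertonParam → ℝ) : @Measure Ω M.futureSigma :=
  @Measure.bind _ _ _ M.futureSigma (M.posterior θ₀ ω π) M.marketMeasure

/-- The subjective mean-corrected pricing measure `Q_π(A) = ∫ Q_θ(A) f_τ(θ|π) dθ`, `A ∈ ℱ⁺_T`. -/
def subjectivePricingMeasure (M : MertonMarket Ω) (θ₀ : MertonParam) (ω : Ω)
    (π : MertonParam → ℝ) : @Measure Ω M.futureSigma :=
  @Measure.bind _ _ _ M.futureSigma (M.posterior θ₀ ω π) M.pricingMeasure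

theorem measurable_marketMeasure (M : MertonMarket Ω) :
    @Measurable _ _ _ (@Measure.instMeasurableSpace Ω M.futureSigma) M.marketMeasure := by
  refine @Measure.measurable_of_measurable_coe _ _ M.futureSigma _ _ (fun A hA => ?_)
  have h : (fun θ => M.marketMeasure θ A) = fun θ => M.P θ A := by
    funext θ
    exact trim_measurableSet_eq _ hA
  rw [h]
  exact M.measurable_P A hA

theorem measurable_intensity : Measurable MertonParam.intensity :=
  measurable_fst.comp measurable_subtype_coe

theorem measurable_jumpVar : Measurable MertonParam.jumpVar :=
  (measurable_fst.comp measurable_snd).comp measurable_subtype_coe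

theorem measurable_jumpMean : Measurable MertonParam.jumpMean :=
  (measurable_snd.comp measurable_snd).comp measurable_subtype_coe

theorem measurable_withDensity_family {α β : Type*} [MeasurableSpace α] {m : MeasurableSpace β}
    (κ : α → Measure β) (hκ : Measurable κ) (hp : ∀ a, IsProbabilityMeasure (κ a))
    (f : α → β → ENNReal) (hf : Measurable (Function.uncurry f)) :
    Measurable (fun a => (κ a).withDensity (f a)) := by
  let K : Kernel α β := ⟨κ, hκ⟩
  have hK : IsMarkovKernel K := ⟨hp⟩
  have h : (fun a => (κ a).withDensity (f a)) = K.withDensity f := by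
    funext a
    rw [Kernel.withDensity_apply K hf]
    rfl
  rw [h]
  exact Kernel.measurable _

theorem isProbabilityMeasure_marketMeasure (M : MertonMarket Ω) (θ : MertonParam) :
    IsProbabilityMeasure (M.marketMeasure θ) := by
  have := M.isProb θ
  constructor
  rw [marketMeasure, trim_measurableSet_eq _ MeasurableSet.univ, measure_univ]

theorem measurable_pricingMeasure (M : MertonMarket Ω) :
    @Measurable _ _ _ (@Measure.instMeasurableSpace Ω M.futureSigma) M.pricingMeasure := by
  refine @measurable_withDensity_family _ _ _ M.futureSigma M.marketMeasure
    M.measurable_marketMeasure M.isProbabilityMeasure_marketMeasure _ ?_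
  have hW : @Measurable _ _ M.futureSigma _ (M.W M.T) := M.adapted_W ⟨M.T, M.T_pos.le, le_rfl⟩
  have hμ : Measurable M.meanCorrection := by
    unfold meanCorrection
    have h1 := measurable_intensity
    have h2 := measurable_jumpVar
    have h3 := measurable_jumpMean
    fun_prop
  have h1 : @Measurable _ _ (@Prod.instMeasurableSpace _ _ _ M.futureSigma) _
      (fun p : MertonParam × Ω => M.W M.T p.2) :=
    @Measurable.comp _ _ _ (@Prod.instMeasurableSpace _ _ _ M.futureSigma) M.futureSigma _ _ _ hW
      (@measurable_snd _ _ _ M.futureSigma)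
  have h2 : @Measurable _ _ (@Prod.instMeasurableSpace _ _ _ M.futureSigma) _
      (fun p : MertonParam × Ω => M.meanCorrection p.1) :=
    @Measurable.comp _ _ _ (@Prod.instMeasurableSpace _ _ _ M.futureSigma) _ _ M.meanCorrection _ hμ
      (@measurable_fst _ _ _ M.futureSigma)
  refine ENNReal.measurable_ofReal.comp (Real.measurable_exp.comp ?_)
  exact ((h2.div_const _).mul h1).sub ((((h2.div_const _).pow_const 2).mul_const _).div_const _)

/-- The subjective market measure is given by the mixture formula. -/
theorem subjectiveMarketMeasure_apply (M : MertonMarket Ω) (θ₀ : MertonParam) (ω : Ω)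
    (π : MertonParam → ℝ) {A : Set Ω} (hA : MeasurableSet[M.futureSigma] A) :
    M.subjectiveMarketMeasure θ₀ ω π A = ∫⁻ θ, M.marketMeasure θ A ∂M.posterior θ₀ ω π :=
  @Measure.bind_apply _ _ _ M.futureSigma _ _ _ hA M.measurable_marketMeasure.aemeasurable

/-- The subjective pricing measure is given by the mixture formula. -/
theorem subjectivePricingMeasure_apply (M : MertonMarket Ω) (θ₀ : MertonParam) (ω : Ω)
    (π : MertonParam → ℝ) {A : Set Ω} (hA : MeasurableSet[M.futureSigma] A) :
    M.subjectivePricingMeasure θ₀ ω π A = ∫⁻ θ, M.pricingMeasure θ A ∂M.posterior θ₀ ω π :=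
  @Measure.bind_apply _ _ _ M.futureSigma _ _ _ hA M.measurable_pricingMeasure.aemeasurable

end MertonMarket

/-- `π` is a prior function on the parameter space: non-negative, continuous and bounded. -/
structure IsPriorFunction (π : MertonParam → ℝ) : Prop where
  nonneg : ∀ θ, 0 ≤ π θ
  continuous : Continuous π
  bounded : ∃ C, ∀ θ, π θ ≤ C

/-- The measure `π(θ) dθ`. -/
def priorMeasure (π : MertonParam → ℝ) : Measure MertonParam :=
  MertonParam.lebesgue.withDensity (fun θ => ENNReal.ofReal (π θ))

/-- `Q` is an equivalent martingale measure for `P`: both are probability measures, they have the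
same null sets, and the discounted price is a martingale under `Q`. -/
structure IsEquivalentMartingaleMeasure {Ω ι : Type*} [Preorder ι] {m : MeasurableSpace Ω}
    (P Q : Measure Ω) (ℱ : Filtration ι m) (S : ι → Ω → ℝ) : Prop where
  isProb_P : IsProbabilityMeasure P
  isProb_Q : IsProbabilityMeasure Q
  ac : Q ≪ P
  ac' : P ≪ Q
  martingale : Martingale S ℱ Q

end

open scoped ENNReal NNReal

noncomputable section

/-! The theorem is proved for each fixed parameter and then mixed over the posterior.

Fix `θ` and put `a = μ_θ / σ`. For `s ≤ t`, the product `L_T e^{-ρt} S_t` is a factor known at time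
`s` and free of `t`, times the exponential of `(a + σ)(W_t - W_s) + a(W_T - W_t) + (J_t - J_s)`,
which is independent of `ℱ s`. The latter has expectation `exp (a²(T - s)/2 + (t - s)(aσ + σ²/2 +
λ(e^{δ²/2 + m} - 1)))`, and the mean correction is chosen to make the second bracket vanish. So the
`Q_θ`-integral of the discounted price over an event of `ℱ s` does not depend on `t ≥ s`
(`setLIntegral_discountedPrice`).

This property is linear in the measure and the filtration does not depend on `θ`, so it passes to
the mixture `Q_π'` by Tonelli. Working with lower integrals postpones integrability, which follows
at the end from the constant value `S₀` at time `0`.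

For equivalence, `L_T > 0` gives `Q_θ ~ P_θ`, and positivity of the likelihood gives each posterior
the null sets of its prior. Mixing equivalent kernels over equivalent measures gives equivalent
measures. -/

/-! ### Exponential moments of Gaussian and Poisson laws -/

theorem lintegral_exp_mul_gaussianReal (m : ℝ) (v : ℝ≥0) (c : ℝ) :
    ∫⁻ x, ENNReal.ofReal (Real.exp (c * x)) ∂gaussianReal m v
      = ENNReal.ofReal (Real.exp (m * c + v * c ^ 2 / 2)) := by
  rw [← ofReal_integral_eq_lintegral_ofReal (integrable_exp_mul_gaussianReal c)
    (ae_of_all _ fun x => (Real.exp_pos _).le)]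
  congr 1
  exact congrFun (mgf_fun_id_gaussianReal (μ := m) (v := v)) c

/-- The exponential series of `r a`, multiplied by `e^{-r}`; its terms are non-negative because `a ≥
0`, so the sum may be taken in `ℝ≥0∞`. -/
theorem lintegral_pow_poissonMeasure (r : ℝ≥0) {a : ℝ} (ha : 0 ≤ a) :
    ∫⁻ n, ENNReal.ofReal a ^ n ∂poissonMeasure r
      = ENNReal.ofReal (Real.exp (r * (a - 1))) := by
  have h := (NormedSpace.expSeries_div_hasSum_exp ((r : ℝ) * a)).mul_left (Real.exp (-r))
  rw [← Real.exp_eq_exp_ℝ, ← Real.exp_add] at h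
  rw [lintegral_countable', show (r : ℝ) * (a - 1) = -r + r * a by ring, ← h.tsum_eq,
    ENNReal.ofReal_tsum_of_nonneg (fun n => by positivity) h.summable]
  refine tsum_congr fun n => ?_
  rw [poissonMeasure_singleton, ← ENNReal.ofReal_pow ha, ← ENNReal.ofReal_mul (by positivity)]
  congr 1
  rw [mul_pow]
  ring

/-! ### Mixtures, martingales and densities -/

/-- Mixtures preserve absolute continuity. -/
theorem MeasureTheory.Measure.AbsolutelyContinuous.bind {α β : Type*} [MeasurableSpace α]
    {m : MeasurableSpace β} {μ ν : Measure α} {κ η : α → Measure β} (hμν : μ ≪ ν)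
    (hκ : Measurable κ) (hη : Measurable η) (h : ∀ a, κ a ≪ η a) : μ.bind κ ≪ ν.bind η := by
  refine Measure.AbsolutelyContinuous.mk fun s hs h0 => ?_
  rw [Measure.bind_apply hs hη.aemeasurable,
    lintegral_eq_zero_iff (f := fun a => η a s) ((Measure.measurable_coe hs).comp hη)] at h0
  rw [Measure.bind_apply hs hκ.aemeasurable,
    lintegral_eq_zero_iff (f := fun a => κ a s) ((Measure.measurable_coe hs).comp hκ)]
  filter_upwards [hμν.ae_le h0] with a ha
  exact h a ha

/-- A non-negative adapted process with constant integrals over present events is a martingale. -/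
theorem martingale_of_setLIntegral_eq {Ω ι : Type*} [Preorder ι] {m : MeasurableSpace Ω}
    {Q : Measure Ω} [IsFiniteMeasure Q] {ℱ : Filtration ι m} {f : ι → Ω → ℝ}
    (hadp : ∀ i, Measurable[ℱ i] (f i)) (hnn : ∀ i ω, 0 ≤ f i ω)
    (hfin : ∀ i, ∫⁻ ω, ENNReal.ofReal (f i ω) ∂Q ≠ ∞)
    (heq : ∀ i j, i ≤ j → ∀ A, MeasurableSet[ℱ i] A →
      ∫⁻ ω in A, ENNReal.ofReal (f j ω) ∂Q = ∫⁻ ω in A, ENNReal.ofReal (f i ω) ∂Q) :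
    Martingale f ℱ Q := by
  have hm : ∀ i, Measurable (f i) := fun i => (hadp i).mono (ℱ.le i) le_rfl
  have hint : ∀ i, Integrable (f i) Q := fun i =>
    (lintegral_ofReal_ne_top_iff_integrable (hm i).aestronglyMeasurable
      (ae_of_all _ (hnn i))).1 (hfin i)
  refine ⟨fun i => (hadp i).stronglyMeasurable, fun i j hij => ?_⟩
  refine (ae_eq_condExp_of_forall_setIntegral_eq (ℱ.le i) (hint j)
    (fun A _ _ => (hint i).integrableOn) (fun A hA _ => ?_)
    (hadp i).stronglyMeasurable.aestronglyMeasurable).symm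
  rw [integral_eq_lintegral_of_nonneg_ae (ae_of_all _ (hnn i)) (hm i).aestronglyMeasurable,
    integral_eq_lintegral_of_nonneg_ae (ae_of_all _ (hnn j)) (hm j).aestronglyMeasurable,
    heq i j hij A hA]

theorem setLIntegral_bind {α β : Type*} [MeasurableSpace α] {m : MeasurableSpace β}
    {μ : Measure α} {κ : α → Measure β} (hκ : Measurable κ) {A : Set β} (hA : MeasurableSet A)
    {f : β → ℝ≥0∞} (hf : Measurable f) :
    ∫⁻ b in A, f b ∂μ.bind κ = ∫⁻ a, ∫⁻ b in A, f b ∂κ a ∂μ := by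
  simp_rw [← lintegral_indicator hA]
  exact Measure.lintegral_bind hκ.aemeasurable (hf.indicator hA).aemeasurable

/-- The density `f g / c` of `f g` with `f > 0` has the null sets of `g`. -/
theorem withDensity_ofReal_mul_div_absolutelyContinuous {α : Type*} [MeasurableSpace α]
    {μ : Measure α} {f f' g g' : α → ℝ} {c c' : ℝ} (hc' : 0 < c')
    (hf' : ∀ a, 0 < f' a)
    (hg : Measurable g) (hg' : Measurable g') (hg0 : ∀ a, 0 ≤ g a)
    (hfg : AEMeasurable (fun a => f a * g a) μ)
    (hfg' : AEMeasurable (fun a => f' a * g' a) μ)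
    (h : μ.withDensity (fun a => ENNReal.ofReal (g a))
      ≪ μ.withDensity (fun a => ENNReal.ofReal (g' a))) :
    μ.withDensity (fun a => ENNReal.ofReal (f a * g a / c))
      ≪ μ.withDensity (fun a => ENNReal.ofReal (f' a * g' a / c')) := by
  intro s hs
  -- Only the products are assumed a.e. measurable: for the likelihood this comes with integrability
  -- against the prior, so no separate measurability of `f` is needed.
  rw [withDensity_apply_eq_zero' (hfg'.div_const _).ennreal_ofReal] at hs
  rw [withDensity_apply_eq_zero' (hfg.div_const _).ennreal_ofReal]
  have h1 : μ.withDensity (fun a => ENNReal.ofReal (g' a)) s = 0 := by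
    rw [withDensity_apply_eq_zero hg'.ennreal_ofReal]
    refine measure_mono_null (Set.inter_subset_inter_left _ fun a ha => ?_) hs
    have : 0 < g' a := by simpa using ha
    have := hf' a
    simp only [ne_eq, ENNReal.ofReal_eq_zero, not_le, Set.mem_ofPred_eq]
    positivity
  have h2 := h h1
  rw [withDensity_apply_eq_zero hg.ennreal_ofReal] at h2
  refine measure_mono_null (Set.inter_subset_inter_left _ fun a ha => ?_) h2
  -- In this direction a non-zero quotient already forces `g a ≠ 0`; the signs of `f` and `c` play
  -- no role.
  have h3 : f a * g a / c ≠ 0 := fun h => ha (by simp [h])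
  have h4 : g a ≠ 0 := by rintro h; simp [h] at h3
  simpa using lt_of_le_of_ne (hg0 a) h4.symm

/-! ### Oriented sums of jump heights -/

/-- The extension of a sequence indexed by the non-zero integers by `0`. -/
def zeroExtend (y : {j : ℤ // j ≠ 0} → ℝ) (j : ℤ) : ℝ := if h : j ≠ 0 then y ⟨j, h⟩ else 0

theorem measurable_zeroExtend (j : ℤ) : Measurable (fun y => zeroExtend y j) := by
  unfold zeroExtend
  split_ifs
  · exact measurable_pi_apply _
  · exact measurable_const

/-- Independence is stated for families indexed by `j ≠ 0`, so the jump part must be a measurable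
function of the count and such a family. The count is discrete, and for a fixed count the sum is
finite. -/
theorem measurable_jumpSum_zeroExtend :
    Measurable (fun p : ℤ × ({j : ℤ // j ≠ 0} → ℝ) => jumpSum (zeroExtend p.2) p.1) := by
  refine measurable_from_prod_countable_right fun n => ?_
  exact Measurable.fun_sub
    (Finset.measurable_fun_sum (Finset.Icc 1 n) fun j _ => measurable_zeroExtend j)
    (Finset.measurable_fun_sum (Finset.Icc n (-1)) fun j _ => measurable_zeroExtend j)

theorem Measurable.jumpSum_zeroExtend {α : Type*} [MeasurableSpace α] {n : α → ℤ}
    {y : α → {j : ℤ // j ≠ 0} → ℝ} (hn : Measurable n) (hy : Measurable y) :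
    Measurable fun a => jumpSum (zeroExtend (y a)) (n a) := by
  have h := measurable_jumpSum_zeroExtend.comp (hn.prodMk hy)
  exact h

/-- Neither `Icc 1 n` nor `Icc n (-1)` contains `0`, so the default value never enters. -/
theorem jumpSum_zeroExtend (y : ℤ → ℝ) (n : ℤ) :
    jumpSum (zeroExtend fun j => y j) n = jumpSum y n := by
  unfold jumpSum
  congr 1 <;> refine Finset.sum_congr rfl fun j hj => ?_ <;> rw [Finset.mem_Icc] at hj <;>
    exact dif_pos (by omega)

theorem jumpSum_zero (y : ℤ → ℝ) : jumpSum y 0 = 0 := by simp [jumpSum]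

theorem jumpSum_sub_jumpSum (y : ℤ → ℝ) {k l : ℤ} (hk : 0 ≤ k) (hkl : k ≤ l) :
    jumpSum y l - jumpSum y k = ∑ j ∈ Finset.Ioc k l, y j := by
  have h : ∀ n : ℤ, 0 ≤ n → jumpSum y n = ∑ j ∈ Finset.Ioc 0 n, y j := fun n hn => by
    rw [jumpSum, Finset.Icc_eq_empty (a := n) (by omega), Finset.sum_empty, sub_zero]
    exact Finset.sum_congr (by ext j; simp only [Finset.mem_Icc, Finset.mem_Ioc]; omega)
      fun _ _ => rfl
  rw [h k hk, h l (hk.trans hkl), sub_eq_iff_eq_add', ← Finset.sum_union]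
  · rw [Finset.Ioc_union_Ioc_eq_Ioc hk hkl]
  · exact Finset.disjoint_left.2 fun a ha hb => by
      rw [Finset.mem_Ioc] at ha hb
      omega

/-! ### Exponential moments of increments under `P θ` -/

namespace MertonMarket

variable {Ω : Type*} [mΩ : MeasurableSpace Ω]

theorem lintegral_exp_Y (M : MertonMarket Ω) (θ : MertonParam) {j : ℤ} (hj : j ≠ 0) :
    ∫⁻ ω, ENNReal.ofReal (Real.exp (M.Y j ω)) ∂M.P θ
      = ENNReal.ofReal (Real.exp (θ.jumpVar / 2 + θ.jumpMean)) := by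
  rw [(M.Y_law θ j hj).lintegral_comp (f := fun x => ENNReal.ofReal (Real.exp x))
    (by fun_prop), MertonParam.jumpLaw]
  have h := lintegral_exp_mul_gaussianReal θ.jumpMean θ.jumpVar.toNNReal 1
  simp only [one_mul] at h
  rw [h, Real.coe_toNNReal _ (show 0 ≤ θ.jumpVar from θ.2.2.le)]
  congr 2
  ring

theorem lintegral_exp_jumpSum_sub (M : MertonMarket Ω) (θ : MertonParam) {k l : ℤ} (hk : 0 ≤ k)
    (hkl : k ≤ l) :
    ∫⁻ ω, ENNReal.ofReal (Real.exp (jumpSum (M.Y · ω) l - jumpSum (M.Y · ω) k)) ∂M.P θ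
      = ENNReal.ofReal (Real.exp (θ.jumpVar / 2 + θ.jumpMean)) ^ (l - k).toNat := by
  -- Since `k ≥ 0`, all `l - k` indices are positive, so each carries one of the i.i.d. heights.
  have hmem : ∀ j ∈ Finset.Ioc k l, j ≠ 0 := fun j hj => by
    rw [Finset.mem_Ioc] at hj
    omega
  have hprod : ∀ ω, ENNReal.ofReal (Real.exp (jumpSum (M.Y · ω) l - jumpSum (M.Y · ω) k))
      = ∏ j ∈ (Finset.Ioc k l).subtype (· ≠ 0), ENNReal.ofReal (Real.exp (M.Y j ω)) := fun ω => by
    rw [jumpSum_sub_jumpSum _ hk hkl, Real.exp_sum,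
      ENNReal.ofReal_prod_of_nonneg fun _ _ => (Real.exp_pos _).le]
    exact (Finset.prod_subtype_of_mem (fun j => ENNReal.ofReal (Real.exp (M.Y j ω))) hmem).symm
  simp_rw [hprod]
  rw [lintegral_prod_eq_prod_lintegral_of_indepFun _
    (fun (j : {j : ℤ // j ≠ 0}) ω => ENNReal.ofReal (Real.exp (M.Y j ω)))
    ((M.Y_iIndep θ).comp (fun _ x => ENNReal.ofReal (Real.exp x)) fun _ => by fun_prop)
    (fun j => ENNReal.measurable_ofReal.comp (Real.measurable_exp.comp (M.measurable_Y j j.2)))]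
  rw [Finset.prod_congr rfl fun j _ => M.lintegral_exp_Y θ j.2, Finset.prod_const,
    Finset.card_subtype, Finset.filter_true_of_mem hmem, Int.card_Ioc]

theorem measurable_Y_family (M : MertonMarket Ω) :
    Measurable (fun ω (j : {j : ℤ // j ≠ 0}) => M.Y j ω) :=
  measurable_pi_lambda _ fun j => M.measurable_Y j j.2

theorem N_nonneg (M : MertonMarket Ω) {t : ℝ} (ht : t ∈ Set.Icc 0 M.T) (ω : Ω) : 0 ≤ M.N t ω := by
  rw [← M.N_zero ω]
  exact M.N_mono ω ⟨by linarith [M.τ_pos], M.T_pos.le⟩ ⟨by linarith [M.τ_pos, ht.1], ht.2⟩ ht.1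

theorem mem_Icc_neg_τ (M : MertonMarket Ω) {t : ℝ} (ht : t ∈ Set.Icc 0 M.T) :
    t ∈ Set.Icc (-M.τ) M.T :=
  ⟨by linarith [M.τ_pos, ht.1], ht.2⟩

theorem jumpSum_zeroExtend_Y (M : MertonMarket Ω) (ω : Ω) (n : ℤ) :
    jumpSum (zeroExtend fun j => M.Y j ω) n = jumpSum (M.Y · ω) n :=
  jumpSum_zeroExtend (M.Y · ω) n

/-- The exponential moment of an increment of the compound Poisson process. -/
theorem lintegral_exp_jump_increment (M : MertonMarket Ω) (θ : MertonParam) {s t : ℝ}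
    (hs : s ∈ Set.Icc 0 M.T) (ht : t ∈ Set.Icc 0 M.T) (hst : s ≤ t) :
    ∫⁻ ω, ENNReal.ofReal (Real.exp
        (jumpSum (M.Y · ω) (M.N t ω) - jumpSum (M.Y · ω) (M.N s ω))) ∂M.P θ
      = ENNReal.ofReal (Real.exp (θ.intensity * (t - s)
          * (Real.exp (θ.jumpVar / 2 + θ.jumpMean) - 1))) := by
  have := M.isProb θ
  have hs' := M.mem_Icc_neg_τ hs
  have ht' := M.mem_Icc_neg_τ ht
  let G : (ℤ × ℤ) × ({j : ℤ // j ≠ 0} → ℝ) → ℝ≥0∞ := fun p =>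
    ENNReal.ofReal (Real.exp (jumpSum (zeroExtend p.2) p.1.2 - jumpSum (zeroExtend p.2) p.1.1))
  have hG : Measurable G := by
    have h1 := Measurable.jumpSum_zeroExtend
      (measurable_snd.comp measurable_fst :
        Measurable fun p : (ℤ × ℤ) × ({j : ℤ // j ≠ 0} → ℝ) => p.1.2) measurable_snd
    have h2 := Measurable.jumpSum_zeroExtend
      (measurable_fst.comp measurable_fst :
        Measurable fun p : (ℤ × ℤ) × ({j : ℤ // j ≠ 0} → ℝ) => p.1.1) measurable_snd
    exact (h1.fun_sub h2).exp.ennreal_ofReal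
  have hN : Measurable fun ω => (M.N s ω, M.N t ω) :=
    (M.measurable_N s hs').prodMk (M.measurable_N t ht')
  have hY := M.measurable_Y_family
  have hind : IndepFun (fun ω => (M.N s ω, M.N t ω))
      (fun ω (j : {j : ℤ // j ≠ 0}) => M.Y j ω) (M.P θ) :=
    (M.indep_N_Y θ).comp (φ := fun n => (n ⟨s, hs'⟩, n ⟨t, ht'⟩)) (ψ := id)
      ((measurable_pi_apply _).prodMk (measurable_pi_apply _)) measurable_id
  calc _ = ∫⁻ ω, G ((M.N s ω, M.N t ω), fun j => M.Y j ω) ∂M.P θ := by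
        simp only [G, jumpSum_zeroExtend_Y]
    -- Independence of `N` and `Y` allows the counts to be frozen while the heights are averaged.
    _ = ∫⁻ ω, ∫⁻ ω', G ((M.N s ω, M.N t ω), fun j => M.Y j ω') ∂M.P θ ∂M.P θ := by
        rw [← lintegral_map hG (hN.prodMk hY),
          (indepFun_iff_map_prod_eq_prod_map_map hN.aemeasurable hY.aemeasurable).1 hind,
          lintegral_prod _ hG.aemeasurable, lintegral_map Measurable.of_discrete hN]
        refine lintegral_congr fun ω => ?_
        exact lintegral_map (hG.comp measurable_prodMk_left) hY
    _ = ∫⁻ ω, ENNReal.ofReal (Real.exp (θ.jumpVar / 2 + θ.jumpMean))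
          ^ (M.N t ω - M.N s ω).toNat ∂M.P θ := by
        refine lintegral_congr fun ω => ?_
        simp only [G, jumpSum_zeroExtend_Y]
        exact M.lintegral_exp_jumpSum_sub θ (M.N_nonneg hs ω) (M.N_mono ω hs' ht' hst)
    -- The generating function of the Poisson increment, evaluated at the mean of `e^{Y_j}`.
    _ = _ := by
        rw [(M.N_law θ s hs' t ht' hst).lintegral_comp
          (f := fun z => ENNReal.ofReal (Real.exp (θ.jumpVar / 2 + θ.jumpMean)) ^ z.toNat)
          Measurable.of_discrete.aemeasurable, lintegral_map .of_discrete .of_discrete]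
        simp only [Int.toNat_natCast]
        rw [lintegral_pow_poissonMeasure _ (Real.exp_pos _).le, Real.coe_toNNReal]
        exact mul_nonneg (show 0 ≤ θ.intensity from θ.2.1.le) (sub_nonneg.2 hst)

theorem lintegral_exp_W_increment (M : MertonMarket Ω) (θ : MertonParam) {s t : ℝ}
    (hs : s ∈ Set.Icc 0 M.T) (ht : t ∈ Set.Icc 0 M.T) (hst : s ≤ t) (c : ℝ) :
    ∫⁻ ω, ENNReal.ofReal (Real.exp (c * (M.W t ω - M.W s ω))) ∂M.P θ
      = ENNReal.ofReal (Real.exp (c ^ 2 * (t - s) / 2)) := by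
  rw [(M.W_law θ s (M.mem_Icc_neg_τ hs) t (M.mem_Icc_neg_τ ht) hst).lintegral_comp
    (f := fun x => ENNReal.ofReal (Real.exp (c * x))) (by fun_prop),
    lintegral_exp_mul_gaussianReal, Real.coe_toNNReal _ (sub_nonneg.2 hst)]
  congr 2
  ring

/-- Two increments are needed because the Girsanov density involves `W` at `T` and the price at `t`:
the coefficients of `W` differ on `[s, t]` and `[t, T]`. -/
theorem lintegral_exp_W_two_increments (M : MertonMarket Ω) (θ : MertonParam) {s t : ℝ}
    (hs : s ∈ Set.Icc 0 M.T) (ht : t ∈ Set.Icc 0 M.T) (hst : s ≤ t) (c d : ℝ) :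
    ∫⁻ ω, ENNReal.ofReal (Real.exp (c * (M.W t ω - M.W s ω)))
        * ENNReal.ofReal (Real.exp (d * (M.W M.T ω - M.W t ω))) ∂M.P θ
      = ENNReal.ofReal (Real.exp (c ^ 2 * (t - s) / 2 + d ^ 2 * (M.T - t) / 2)) := by
  have hT : M.T ∈ Set.Icc 0 M.T := ⟨M.T_pos.le, le_rfl⟩
  have hm : ∀ u ∈ Set.Icc 0 M.T, Measurable (M.W u) :=
    fun u hu => M.measurable_W u (M.mem_Icc_neg_τ hu)
  have hmeas : ∀ c : ℝ, Measurable fun x => ENNReal.ofReal (Real.exp (c * x)) :=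
    fun c => by fun_prop
  have hind := (M.W_indepIncr θ).indepFun_sub_sub (r := ⟨s, M.mem_Icc_neg_τ hs⟩)
    (s := ⟨t, M.mem_Icc_neg_τ ht⟩) (t := ⟨M.T, M.mem_Icc_neg_τ hT⟩) hst ht.2
  rw [Real.exp_add, ENNReal.ofReal_mul (Real.exp_pos _).le,
    ← M.lintegral_exp_W_increment θ hs ht hst c, ← M.lintegral_exp_W_increment θ ht hT ht.2 d]
  exact lintegral_mul_eq_lintegral_mul_lintegral_of_indepFun''
    ((hmeas c).comp ((hm t ht).sub (hm s hs))).aemeasurable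
    ((hmeas d).comp ((hm _ hT).sub (hm t ht))).aemeasurable
    (hind.comp (hmeas c) (hmeas d))

/-- The joint exponential moment of future increments of the diffusion and of the jump part. -/
theorem lintegral_exp_increments (M : MertonMarket Ω) (θ : MertonParam) {s t : ℝ}
    (hs : s ∈ Set.Icc 0 M.T) (ht : t ∈ Set.Icc 0 M.T) (hst : s ≤ t) (c d : ℝ) :
    ∫⁻ ω, ENNReal.ofReal (Real.exp (c * (M.W t ω - M.W s ω) + d * (M.W M.T ω - M.W t ω)
        + (jumpSum (M.Y · ω) (M.N t ω) - jumpSum (M.Y · ω) (M.N s ω)))) ∂M.P θ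
      = ENNReal.ofReal (Real.exp (c ^ 2 * (t - s) / 2 + d ^ 2 * (M.T - t) / 2
          + θ.intensity * (t - s) * (Real.exp (θ.jumpVar / 2 + θ.jumpMean) - 1))) := by
  have hT : M.T ∈ Set.Icc 0 M.T := ⟨M.T_pos.le, le_rfl⟩
  have hs' := M.mem_Icc_neg_τ hs
  have ht' := M.mem_Icc_neg_τ ht
  have hT' := M.mem_Icc_neg_τ hT
  let f : (Set.Icc (-M.τ) M.T → ℝ) → ℝ≥0∞ := fun w =>
    ENNReal.ofReal (Real.exp (c * (w ⟨t, ht'⟩ - w ⟨s, hs'⟩)))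
      * ENNReal.ofReal (Real.exp (d * (w ⟨M.T, hT'⟩ - w ⟨t, ht'⟩)))
  let g : (Set.Icc (-M.τ) M.T → ℤ) × ({j : ℤ // j ≠ 0} → ℝ) → ℝ≥0∞ := fun p =>
    ENNReal.ofReal (Real.exp
      (jumpSum (zeroExtend p.2) (p.1 ⟨t, ht'⟩) - jumpSum (zeroExtend p.2) (p.1 ⟨s, hs'⟩)))
  have hf : Measurable f := by fun_prop
  have hg : Measurable g := by
    have h := fun u : Set.Icc (-M.τ) M.T => Measurable.jumpSum_zeroExtend
      ((measurable_pi_apply u).comp measurable_fst :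
        Measurable fun p : (Set.Icc (-M.τ) M.T → ℤ) × ({j : ℤ // j ≠ 0} → ℝ) => p.1 u)
      measurable_snd
    have h1 := (h ⟨t, ht'⟩).fun_sub (h ⟨s, hs'⟩)
    exact h1.exp.ennreal_ofReal
  have hW : Measurable fun ω (u : Set.Icc (-M.τ) M.T) => M.W u ω :=
    measurable_pi_lambda _ fun u => M.measurable_W u u.2
  have hN : Measurable fun ω (u : Set.Icc (-M.τ) M.T) => M.N u ω :=
    measurable_pi_lambda _ fun u => M.measurable_N u u.2
  have key := lintegral_mul_eq_lintegral_mul_lintegral_of_indepFun''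
    (hf.comp hW).aemeasurable (hg.comp (hN.prodMk M.measurable_Y_family)).aemeasurable
    ((M.indep_W_NY θ).comp hf hg)
  simp only [Function.comp_apply, f, g, jumpSum_zeroExtend_Y] at key
  rw [M.lintegral_exp_W_two_increments θ hs ht hst, M.lintegral_exp_jump_increment θ hs ht hst,
    ← ENNReal.ofReal_mul (Real.exp_pos _).le, ← Real.exp_add] at key
  rw [← key]
  refine lintegral_congr fun ω => ?_
  rw [← ENNReal.ofReal_mul (Real.exp_pos _).le, ← Real.exp_add,
    ← ENNReal.ofReal_mul (Real.exp_pos _).le, ← Real.exp_add]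

/-- Under the mean correction, the exponential moment of the future increments that drive the
discounted price times the Girsanov density does not depend on the time `t` of evaluation. -/
theorem lintegral_exp_corrected_increments (M : MertonMarket Ω) (θ : MertonParam) {s t : ℝ}
    (hs : s ∈ Set.Icc 0 M.T) (ht : t ∈ Set.Icc 0 M.T) (hst : s ≤ t) :
    ∫⁻ ω, ENNReal.ofReal (Real.exp
        ((M.meanCorrection θ / M.σ + M.σ) * (M.W t ω - M.W s ω)
          + M.meanCorrection θ / M.σ * (M.W M.T ω - M.W t ω)
          + (jumpSum (M.Y · ω) (M.N t ω) - jumpSum (M.Y · ω) (M.N s ω)))) ∂M.P θ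
      = ENNReal.ofReal (Real.exp ((M.meanCorrection θ / M.σ) ^ 2 * (M.T - s) / 2)) := by
  rw [M.lintegral_exp_increments θ hs ht hst]
  have hσ := M.σ_pos.ne'
  have h : M.meanCorrection θ / M.σ * M.σ = M.meanCorrection θ := div_mul_cancel₀ _ hσ
  have h' : M.meanCorrection θ = -(1 / 2) * M.σ ^ 2
    - θ.intensity * (Real.exp (θ.jumpVar / 2 + θ.jumpMean) - 1) := rfl
  congr 2
  generalize M.meanCorrection θ / M.σ = a at *
  -- The two exponents differ by `(t - s)(aσ + σ²/2 + λ(e^{δ²/2 + m} - 1))`, which is zero since `aσ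
  -- = μ_θ`.
  linear_combination (t - s) * h + (t - s) * h'

/-! ### The discounted price under `Q_θ` -/

/-- Discounting cancels the drift `ρ t`, and `W_T` is split at `s` and `t`. For `s ≤ t` in `[0, T]`,
the first factor is `ℱ s`-measurable and free of `t`; the second involves only increments after `s`.
-/
theorem girsanovDensity_mul_discountedPrice (M : MertonMarket Ω) (θ : MertonParam)
    (s : ℝ) (t : Set.Icc (0 : ℝ) M.T) (ω : Ω) :
    ENNReal.ofReal (M.girsanovDensity θ ω) * ENNReal.ofReal (M.discountedPrice t ω)
      = ENNReal.ofReal (M.S₀ * Real.exp ((M.meanCorrection θ / M.σ + M.σ) * M.W s ω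
          + jumpSum (M.Y · ω) (M.N s ω) - (M.meanCorrection θ / M.σ) ^ 2 * M.T / 2))
        * ENNReal.ofReal (Real.exp
          ((M.meanCorrection θ / M.σ + M.σ) * (M.W t ω - M.W s ω)
            + M.meanCorrection θ / M.σ * (M.W M.T ω - M.W t ω)
            + (jumpSum (M.Y · ω) (M.N t ω) - jumpSum (M.Y · ω) (M.N s ω)))) := by
  have hS := M.S₀_pos.le
  rw [← ENNReal.ofReal_mul (show 0 ≤ M.girsanovDensity θ ω from (Real.exp_pos _).le),
    ← ENNReal.ofReal_mul (by positivity)]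
  congr 1
  rw [girsanovDensity, discountedPrice, S, X, mul_left_comm _ M.S₀, mul_left_comm _ M.S₀,
    ← Real.exp_add, ← Real.exp_add, mul_assoc, ← Real.exp_add]
  congr 2
  ring

theorem measurable_discountedPrice (M : MertonMarket Ω) (t : Set.Icc (0 : ℝ) M.T) :
    Measurable[M.ℱ t] (M.discountedPrice t) := by
  have h1 := M.adapted_W t
  have h2 := M.adapted_jump t
  have h3 : Measurable[M.ℱ t] (M.X t) := (measurable_const.add (h1.const_mul _)).add h2
  exact (h3.exp.const_mul _).const_mul _

theorem measurable_girsanovDensity (M : MertonMarket Ω) (θ : MertonParam) :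
    Measurable[M.futureSigma] (M.girsanovDensity θ) := by
  have h1 := M.adapted_W ⟨M.T, M.T_pos.le, le_rfl⟩
  exact ((h1.const_mul _).sub_const _).exp

theorem discountedPrice_nonneg (M : MertonMarket Ω) (t : Set.Icc (0 : ℝ) M.T) (ω : Ω) :
    0 ≤ M.discountedPrice t ω :=
  mul_nonneg (Real.exp_pos _).le (mul_nonneg M.S₀_pos.le (Real.exp_pos _).le)

theorem discountedPrice_zero (M : MertonMarket Ω) (ω : Ω) :
    M.discountedPrice ⟨0, le_rfl, M.T_pos.le⟩ ω = M.S₀ := by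
  simp [discountedPrice, S, X, M.W_zero, M.N_zero, jumpSum_zero]

/-- Integrals under the pricing measure are integrals under `P θ` against the density. -/
theorem setLIntegral_pricingMeasure (M : MertonMarket Ω) (θ : MertonParam) {A : Set Ω}
    (hA : MeasurableSet[M.futureSigma] A) {f : Ω → ℝ≥0∞} (hf : Measurable[M.futureSigma] f) :
    (∫⁻ ω in A, f ω ∂M.pricingMeasure θ)
      = ∫⁻ ω, A.indicator (fun ω => ENNReal.ofReal (M.girsanovDensity θ ω) * f ω) ω ∂M.P θ := by
  have hg := (M.measurable_girsanovDensity θ).ennreal_ofReal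
  rw [pricingMeasure, setLIntegral_withDensity_eq_setLIntegral_mul _ hg hf hA,
    ← lintegral_indicator hA]
  exact lintegral_trim (M.ℱ.le _) ((hg.mul hf).indicator hA)

/-- Integrals of the discounted price over events of `ℱ s` under `Q_θ` at a later time. -/
theorem setLIntegral_discountedPrice (M : MertonMarket Ω) (θ : MertonParam)
    {s t : Set.Icc (0 : ℝ) M.T} (hst : s ≤ t) {A : Set Ω} (hA : MeasurableSet[M.ℱ s] A) :
    (∫⁻ ω in A, ENNReal.ofReal (M.discountedPrice t ω) ∂M.pricingMeasure θ)
      = (∫⁻ ω, A.indicator (fun ω => ENNReal.ofReal (M.S₀ * Real.exp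
          ((M.meanCorrection θ / M.σ + M.σ) * M.W s ω
            + jumpSum (M.Y · ω) (M.N s ω) - (M.meanCorrection θ / M.σ) ^ 2 * M.T / 2))) ω ∂M.P θ)
        * ENNReal.ofReal (Real.exp ((M.meanCorrection θ / M.σ) ^ 2 * (M.T - s) / 2)) := by
  have hmono : ∀ u : Set.Icc (0 : ℝ) M.T, M.ℱ u ≤ M.futureSigma := fun u => M.ℱ.mono u.2.2
  rw [M.setLIntegral_pricingMeasure θ (hmono s _ hA)
    (((M.measurable_discountedPrice t).mono (hmono t) le_rfl).ennreal_ofReal),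
    ← M.lintegral_exp_corrected_increments θ s.2 t.2 hst]
  simp_rw [M.girsanovDensity_mul_discountedPrice θ s t, Set.indicator_mul_left]
  have hZ : Measurable fun ω (u : Set.Icc (s : ℝ) M.T) =>
      (M.W u ω - M.W s ω, jumpSum (M.Y · ω) (M.N u ω) - jumpSum (M.Y · ω) (M.N s ω)) := by
    refine measurable_pi_lambda _ fun u => ?_
    have hu : (u : ℝ) ∈ Set.Icc 0 M.T := ⟨s.2.1.trans u.2.1, u.2.2⟩
    have h1 : ∀ v : Set.Icc (0 : ℝ) M.T, Measurable (M.W v) :=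
      fun v => (M.adapted_W v).mono (M.ℱ.le v) le_rfl
    have h2 : ∀ v : Set.Icc (0 : ℝ) M.T, Measurable fun ω => jumpSum (M.Y · ω) (M.N v ω) :=
      fun v => (M.adapted_jump v).mono (M.ℱ.le v) le_rfl
    exact ((h1 ⟨u, hu⟩).sub (h1 s)).prodMk ((h2 ⟨u, hu⟩).sub (h2 s))
  refine lintegral_mul_eq_lintegral_mul_lintegral_of_independent_measurableSpace
    (M.ℱ.le s) hZ.comap_le (M.indep_future θ s) ?_ ?_
  · have h1 := M.adapted_W s
    have h2 := M.adapted_jump s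
    exact (((((h1.const_mul _).add h2).sub_const _).exp.const_mul _).ennreal_ofReal).indicator hA
  -- The independent σ-algebra is generated by increments starting at `s`; `W_T - W_t` is the
  -- difference of two of them.
  · let g : (Set.Icc (s : ℝ) M.T → ℝ × ℝ) → ℝ≥0∞ := fun z => ENNReal.ofReal (Real.exp
      ((M.meanCorrection θ / M.σ + M.σ) * (z ⟨t, hst, t.2.2⟩).1
        + M.meanCorrection θ / M.σ * ((z ⟨M.T, s.2.2, le_rfl⟩).1 - (z ⟨t, hst, t.2.2⟩).1)
        + (z ⟨t, hst, t.2.2⟩).2))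
    have hg : Measurable g := by fun_prop
    have h := hg.comp (comap_measurable fun ω (u : Set.Icc (s : ℝ) M.T) =>
      (M.W u ω - M.W s ω, jumpSum (M.Y · ω) (M.N u ω) - jumpSum (M.Y · ω) (M.N s ω)))
    simpa only [g, Function.comp_def, sub_sub_sub_cancel_right] using h

/-! ### Normalization and equivalence -/

/-- The Gaussian moment `exp (a²T/2)` of `exp (a W_T)`, with `a = μ_θ / σ`, cancels the
deterministic factor of `L_T`. -/
theorem isProbabilityMeasure_pricingMeasure (M : MertonMarket Ω) (θ : MertonParam) :
    IsProbabilityMeasure (M.pricingMeasure θ) := by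
  have := M.isProb θ
  have h0 : (0 : ℝ) ∈ Set.Icc 0 M.T := ⟨le_rfl, M.T_pos.le⟩
  have hT : M.T ∈ Set.Icc 0 M.T := ⟨M.T_pos.le, le_rfl⟩
  have hg := (M.measurable_girsanovDensity θ).ennreal_ofReal
  constructor
  have h1 := M.setLIntegral_pricingMeasure θ MeasurableSet.univ
    (f := fun _ => 1) measurable_const
  rw [setLIntegral_one] at h1
  rw [h1]
  have h2 := M.lintegral_exp_W_increment θ h0 hT M.T_pos.le (M.meanCorrection θ / M.σ)
  have h3 : ∀ ω, Set.univ.indicator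
        (fun ω => ENNReal.ofReal (M.girsanovDensity θ ω) * 1) ω
      = ENNReal.ofReal (Real.exp (M.meanCorrection θ / M.σ * (M.W M.T ω - M.W 0 ω)))
        * ENNReal.ofReal (Real.exp (-((M.meanCorrection θ / M.σ) ^ 2 * (M.T - 0) / 2))) :=
    fun ω => by
      rw [Set.indicator_univ, mul_one, ← ENNReal.ofReal_mul (Real.exp_pos _).le, ← Real.exp_add,
        girsanovDensity, M.W_zero, sub_zero, sub_zero, sub_eq_add_neg]
  simp_rw [h3]
  rw [lintegral_mul_const' _ _ ENNReal.ofReal_ne_top, h2,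
    ← ENNReal.ofReal_mul (Real.exp_pos _).le, ← Real.exp_add, add_neg_cancel, Real.exp_zero,
    ENNReal.ofReal_one]

theorem pricingMeasure_absolutelyContinuous (M : MertonMarket Ω) (θ : MertonParam) :
    M.pricingMeasure θ ≪ M.marketMeasure θ :=
  withDensity_absolutelyContinuous _ _

theorem marketMeasure_absolutelyContinuous (M : MertonMarket Ω) (θ : MertonParam) :
    M.marketMeasure θ ≪ M.pricingMeasure θ :=
  withDensity_absolutelyContinuous' (M.measurable_girsanovDensity θ).ennreal_ofReal.aemeasurable
    (ae_of_all _ fun _ => (ENNReal.ofReal_pos.2 (Real.exp_pos _)).ne')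

theorem isProbabilityMeasure_posterior (M : MertonMarket Ω) {θ₀ : MertonParam} {ω : Ω}
    {π : MertonParam → ℝ} (hπ : IsPriorFunction π) (h : M.PosteriorWellDefined θ₀ ω π) :
    IsProbabilityMeasure (M.posterior θ₀ ω π) := by
  constructor
  rw [posterior, withDensity_apply _ .univ, Measure.restrict_univ]
  unfold posteriorDensity
  rw [← ofReal_integral_eq_lintegral_ofReal (h.1.div_const _)
    (ae_of_all _ fun θ => div_nonneg (mul_nonneg (Real.exp_pos _).le (hπ.nonneg θ)) h.2.le),
    integral_div, div_self h.2.ne', ENNReal.ofReal_one]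

/-- Equivalent priors have equivalent posteriors. -/
theorem posterior_absolutelyContinuous (M : MertonMarket Ω) {θ₀ : MertonParam} {ω : Ω}
    {π π' : MertonParam → ℝ} (hπ : IsPriorFunction π) (hπ' : IsPriorFunction π')
    (h : M.PosteriorWellDefined θ₀ ω π) (h' : M.PosteriorWellDefined θ₀ ω π')
    (hac : priorMeasure π ≪ priorMeasure π') : M.posterior θ₀ ω π ≪ M.posterior θ₀ ω π' :=
  withDensity_ofReal_mul_div_absolutelyContinuous h'.2 (fun _ => Real.exp_pos _)
    hπ.continuous.measurable hπ'.continuous.measurable hπ.nonneg h.1.aemeasurable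
    h'.1.aemeasurable hac

end MertonMarket

/-! ### The equivalent martingale measure -/

theorem theorem3p2 {Ω : Type*} [MeasurableSpace Ω] (M : MertonMarket Ω)
    (θ₀ : MertonParam) (ω : Ω) (π π' : MertonParam → ℝ)
    (hπ : IsPriorFunction π) (hπ' : IsPriorFunction π')
    (hac : priorMeasure π ≪ priorMeasure π') (hac' : priorMeasure π' ≪ priorMeasure π)
    (hpost : M.PosteriorWellDefined θ₀ ω π) (hpost' : M.PosteriorWellDefined θ₀ ω π') :
    IsEquivalentMartingaleMeasure (M.subjectiveMarketMeasure θ₀ ω π)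
      (M.subjectivePricingMeasure θ₀ ω π') M.futureFiltration M.discountedPrice := by
  have hp := M.isProbabilityMeasure_posterior hπ hpost
  have hp' := M.isProbabilityMeasure_posterior hπ' hpost'
  have hQ : IsProbabilityMeasure (M.subjectivePricingMeasure θ₀ ω π') :=
    @isProbabilityMeasure_bind _ _ _ M.futureSigma _ _ _
      M.measurable_pricingMeasure.aemeasurable
      (ae_of_all _ M.isProbabilityMeasure_pricingMeasure)
  have hmeas : ∀ t, Measurable[M.futureSigma]
      fun ω => ENNReal.ofReal (M.discountedPrice t ω) := fun t =>
    ((M.measurable_discountedPrice t).mono (M.ℱ.mono t.2.2) le_rfl).ennreal_ofReal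
  have heq : ∀ s t, s ≤ t → ∀ A, MeasurableSet[M.ℱ s] A →
      (∫⁻ ω in A, ENNReal.ofReal (M.discountedPrice t ω) ∂M.subjectivePricingMeasure θ₀ ω π')
        = ∫⁻ ω in A, ENNReal.ofReal (M.discountedPrice s ω)
            ∂M.subjectivePricingMeasure θ₀ ω π' := fun s t hst A hA => by
    have hA' : MeasurableSet[M.futureSigma] A := M.ℱ.mono s.2.2 _ hA
    rw [MertonMarket.subjectivePricingMeasure,
      setLIntegral_bind M.measurable_pricingMeasure hA' (hmeas t),
      setLIntegral_bind M.measurable_pricingMeasure hA' (hmeas s)]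
    -- For each `θ` both inner integrals reduce to one expression in `s` and `A` alone.
    refine lintegral_congr fun θ => ?_
    rw [M.setLIntegral_discountedPrice θ hst hA, M.setLIntegral_discountedPrice θ le_rfl hA]
  refine ⟨@isProbabilityMeasure_bind _ _ _ M.futureSigma _ _ _
      M.measurable_marketMeasure.aemeasurable
      (ae_of_all _ M.isProbabilityMeasure_marketMeasure), hQ,
    (M.posterior_absolutelyContinuous hπ' hπ hpost' hpost hac').bind M.measurable_pricingMeasure
      M.measurable_marketMeasure M.pricingMeasure_absolutelyContinuous,
    (M.posterior_absolutelyContinuous hπ hπ' hpost hpost' hac).bind M.measurable_marketMeasure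
      M.measurable_pricingMeasure M.marketMeasure_absolutelyContinuous,
    martingale_of_setLIntegral_eq M.measurable_discountedPrice M.discountedPrice_nonneg
      (fun t => ?_) heq⟩
  -- Finiteness: over the whole space the integral at `t` equals that at time `0`, where the price
  -- is the constant `S₀` and `Q_π'` has mass one.
  have h := heq ⟨0, le_rfl, M.T_pos.le⟩ t t.2.1 Set.univ MeasurableSet.univ
  rw [Measure.restrict_univ] at h
  rw [h]
  simp [M.discountedPrice_zero]

end
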